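/- For a prime $p$ and a nonempty set $E\subseteq\mathbb{Z}$, let $\mathrm{Int}(E,\mathbb{Z})=\{f\in\mathbb{Q}[x] : f(E)\subseteq\mathbb{Z}\}$, let $I_n$ be the set formed by $0$ and the leading coefficients of the elements of $\mathrm{Int}(E,\mathbb{Z})$ of degree at most $n$, and let $\alpha_{E,p}(n)=-\min\{\nu_p(c) : c\in I_n,\ c\neq 0\}$ whenever this minimum exists. The $p$-valuative capacity of $E$ is $L_{E,p}=\lim_{n\to\infty}\alpha_{E,p}(n)/n$. Proposition. Let $p$ be a prime, $m\ge 0$ an integer and $E\subseteq\mathbb{Z}$ a nonempty union of cosets of $p^m\mathbb{Z}$. Then all $\alpha_{E,p}(n)$ are defined, the limit $L_{E,p}$ exists, and it is a rational number. Moreover, it is recursively computable, in the following sense. There is a single function $F$ with rational values that is computable by an algorithm (its values are quotients of a numerator and a denominator given by total recursive functions) such that for every prime $p$, every $m\ge 0$ and every nonempty finite list of integers $a_1,\dots,a_\ell$, the valuative capacity of $\bigcup_{i=1}^{\ell}(a_i+p^m\mathbb{Z})$ with respect to $p$ is $F(p,m,(a_1,\dots,a_\ell))$, and $F$ satisfies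 the recursion on $m$ $$F(p,0,(a_i)_i)=\frac{1}{p-1},\qquad F(p,m+1,(a_i)_i)=\Bigl(\sum_{j}\bigl(1+F(p,m,A_j)\bigr)^{-1}\Bigr)^{-1},$$ where, for $0\le j<p$, $A_j$ is the list of the integers $(a_i-j)/p$ for those $i$ with $a_i\equiv j\pmod p$, and the sum is over those $j$ for which $A_j$ is nonempty. -/

import Mathlib

/-- The ring `Int(E, ℤ)` of polynomials over `ℚ` that take integer values on `E`. -/
def intValuedPolynomials (E : Set ℤ) : Subring (Polynomial ℚ) where
  carrier := {f | ∀ a ∈ E, ∃ z : ℤ, f.eval (a : ℚ) = (z : ℚ)}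
  mul_mem' := by
    intro f g hf hg a ha
    obtain ⟨x, hx⟩ := hf a ha
    obtain ⟨y, hy⟩ := hg a ha
    exact ⟨x * y, by simp [hx, hy]⟩
  one_mem' := fun a _ => ⟨1, by simp⟩
  add_mem' := by
    intro f g hf hg a ha
    obtain ⟨x, hx⟩ := hf a ha
    obtain ⟨y, hy⟩ := hg a ha
    exact ⟨x + y, by simp [hx, hy]⟩
  zero_mem' := fun a _ => ⟨0, by simp⟩
  neg_mem' := by
    intro f hf a ha
    obtain ⟨x, hx⟩ := hf a ha
    exact ⟨-x, by simp [hx]⟩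

theorem X_mem_intValuedPolynomials (E : Set ℤ) :
    (Polynomial.X : Polynomial ℚ) ∈ intValuedPolynomials E :=
  fun a _ => ⟨a, by simp⟩

theorem exists_leadingCoeff_add_aux (E : Set ℤ) (n : ℕ) {f g : Polynomial ℚ}
    (hf : f ∈ intValuedPolynomials E) (hg : g ∈ intValuedPolynomials E)
    (hfn : f.natDegree ≤ n) (hle : g.natDegree ≤ f.natDegree) :
    ∃ h ∈ intValuedPolynomials E, h.natDegree ≤ n ∧
      h.leadingCoeff = f.leadingCoeff + g.leadingCoeff := by
  by_cases hs : f.leadingCoeff + g.leadingCoeff = 0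
  · exact ⟨0, Subring.zero_mem _, by simp, by simp [hs]⟩
  have hdeg : (f + g * Polynomial.X ^ (f.natDegree - g.natDegree)).natDegree ≤ f.natDegree := by
    refine Polynomial.natDegree_add_le_of_degree_le le_rfl ?_
    refine Polynomial.natDegree_mul_le.trans ?_
    rw [Polynomial.natDegree_X_pow]
    omega
  have hc : (f + g * Polynomial.X ^ (f.natDegree - g.natDegree)).coeff f.natDegree =
      f.leadingCoeff + g.leadingCoeff := by
    rw [Polynomial.coeff_add, Polynomial.coeff_mul_X_pow', if_pos (Nat.sub_le _ _),
      Nat.sub_sub_self hle]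
    rfl
  refine ⟨f + g * Polynomial.X ^ (f.natDegree - g.natDegree),
    Subring.add_mem _ hf (Subring.mul_mem _ hg
      (Subring.pow_mem _ (X_mem_intValuedPolynomials E) _)), hdeg.trans hfn, ?_⟩
  have heq := le_antisymm hdeg (Polynomial.le_natDegree_of_ne_zero (by rw [hc]; exact hs))
  rw [Polynomial.leadingCoeff, heq, hc]

/-- The `n`-th characteristic ideal of `E`: the `ℤ`-submodule of `ℚ` formed by the leading
coefficients of the elements of `Int(E, ℤ)` of degree at most `n`, and `0` (which is the leading
coefficient of the zero polynomial). -/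
def characteristicIdeal (E : Set ℤ) (n : ℕ) : Submodule ℤ ℚ where
  carrier := {c | ∃ f ∈ intValuedPolynomials E, f.natDegree ≤ n ∧ f.leadingCoeff = c}
  zero_mem' := ⟨0, Subring.zero_mem _, by simp, by simp⟩
  add_mem' := by
    rintro _ _ ⟨f, hf, hfn, rfl⟩ ⟨g, hg, hgn, rfl⟩
    rcases le_total g.natDegree f.natDegree with h | h
    · exact exists_leadingCoeff_add_aux E n hf hg hfn h
    · rw [add_comm]
      exact exists_leadingCoeff_add_aux E n hg hf hgn h
  smul_mem' := by
    rintro z _ ⟨f, hf, hfn, rfl⟩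
    refine ⟨(z : Polynomial ℚ) * f, Subring.mul_mem _ (intCast_mem (intValuedPolynomials E) z) hf, ?_, ?_⟩
    · refine Polynomial.natDegree_mul_le.trans ?_
      simpa using hfn
    · rw [Polynomial.leadingCoeff_mul]
      have h : (z : Polynomial ℚ) = Polynomial.C (z : ℚ) := by simp
      rw [h, Polynomial.leadingCoeff_C, zsmul_eq_mul]

/-- `α` is the characteristic sequence of `E` with respect to `p`: for every `n` the `p`-adic
valuation of the `n`-th characteristic ideal, which is the least `p`-adic valuation of a nonzero
element of it, exists and equals `-α n`. -/
def IsCharacteristicSequence (p : ℕ) (E : Set ℤ) (α : ℕ → ℤ) : Prop :=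
  ∀ n : ℕ, IsLeast {v : ℤ | ∃ c ∈ characteristicIdeal E n, c ≠ 0 ∧ padicValRat p c = v} (-α n)

/-- The `p`-valuative capacity of `E` is `L`: the characteristic sequence `α` of `E` with respect
to `p` is defined, and `α n / n` tends to `L`. -/
def HasValuativeCapacity (p : ℕ) (E : Set ℤ) (L : ℝ) : Prop :=
  ∃ α : ℕ → ℤ, IsCharacteristicSequence p E α ∧
    Filter.Tendsto (fun n : ℕ => (α n : ℝ) / (n : ℝ)) Filter.atTop (nhds L)

/-- The coset `a + p ^ m ℤ`. -/
def coset (p m : ℕ) (a : ℤ) : Set ℤ :=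
  {x | ∃ k : ℤ, x = a + (p : ℤ) ^ m * k}

/-- `E` is a union of cosets modulo `p ^ m`. -/
def IsUnionOfCosets (p m : ℕ) (E : Set ℤ) : Prop :=
  ∃ A : Set ℤ, E = ⋃ a ∈ A, coset p m a

/-- The union of the cosets `a + p ^ m ℤ` with `a` in the list `l`. -/
def cosetUnion (p m : ℕ) (l : List ℤ) : Set ℤ :=
  ⋃ a ∈ l, coset p m a

/-- The list of the integers `b` with `j + p * b` in `l` (for `0 ≤ j < p`). The part of
`cosetUnion p (m + 1) l` that is congruent to `j` modulo `p` is
`j + p * cosetUnion p m (residuePart p j l)`. -/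
def residuePart (p j : ℕ) (l : List ℤ) : List ℤ :=
  (l.filter (fun a => a % (p : ℤ) = (j : ℤ))).map (fun a => a / (p : ℤ))

/-- A rational-valued function is computable if it is the quotient of a numerator and a nonzero
denominator that are both computable (total recursive) functions. -/
def ComputableRational {β : Type} [Primcodable β] (F : β → ℚ) : Prop :=
  ∃ (N : β → ℤ) (D : β → ℕ), Computable N ∧ Computable D ∧
    ∀ x, D x ≠ 0 ∧ F x = (N x : ℚ) / (D x : ℚ)

/-! A monic polynomial of degree n with integer roots whose values on E are divisible by p ^ h can
be divided by p ^ h, so α(n) ≥ h. Conversely, Lagrange interpolation at n + 1 points of E writes a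
leading coefficient as a sum of integers over products of differences; if these products have
valuation at most h, then α(n) ≤ h. Hence, if the least number of such roots and the largest number
of such points both grow like K * h, the capacity is 1 / K (`HasGrowth.hasValuativeCapacity`).

The growth rate K obeys simple rules. It is additive over sets in distinct residue classes mod p
(`HasGrowth.biUnion`), because differences across classes are prime to p. It becomes K / (1 + K)
under x ↦ j + p * x (`HasGrowth.image`), because each of about n differences gains one factor p. It
equals p - 1 for ℤ (`hasGrowth_univ`), by Legendre's formula. Splitting a union of cosets mod p ^ (m
+ 1) by residues mod p thus gives a recursion for K in rational numbers, whose reciprocal form is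
the required one.

For computability, the recursion is unrolled bottom-up over tables indexed by residues mod p ^ (m -
k), with fractions of natural numbers as entries; this is primitive recursive. -/

/-- There are `n` integers (with multiplicity) such that the monic polynomial with these roots
takes values divisible by `p ^ h` on `E`. -/
def HasRoots (p : ℕ) (E : Set ℤ) (n h : ℕ) : Prop :=
  ∃ B : Multiset ℤ, B.card = n ∧ ∀ x ∈ E, (p : ℤ) ^ h ∣ (B.map (fun b => x - b)).prod

/-- There are `n` distinct points of `E` such that, for each of them, the product of its differences
with the others is not divisible by `p ^ (h + 1)`. -/
def HasSpread (p : ℕ) (E : Set ℤ) (n h : ℕ) : Prop :=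
  ∃ A : Finset ℤ, (A : Set ℤ) ⊆ E ∧ A.card = n ∧
    ∀ a ∈ A, ¬ (p : ℤ) ^ (h + 1) ∣ ∏ b ∈ A.erase a, (a - b)

/-- The number of roots needed for divisibility by `p ^ h` on `E`, and the number of points that can
be spread with exponent `h` in `E`, both grow like `K * h`. -/
def HasGrowth (p : ℕ) (E : Set ℤ) (K : ℝ) : Prop :=
  (∀ K' > K, ∃ C : ℝ, 0 ≤ C ∧ ∀ h : ℕ, ∃ n : ℕ, (n : ℝ) ≤ K' * h + C ∧ HasRoots p E n h) ∧
  (∀ K' < K, ∃ C : ℝ, 0 ≤ C ∧ ∀ h : ℕ, ∃ n : ℕ, K' * h - C ≤ (n : ℝ) ∧ HasSpread p E n h)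

/-! ### Growth rates: monotonicity and disjoint residue classes -/

theorem HasRoots.mono {p : ℕ} {E : Set ℤ} {n n' h h' : ℕ} (H : HasRoots p E n h) (hn : n ≤ n')
    (hh : h' ≤ h) : HasRoots p E n' h' := by
  obtain ⟨B, hB, H⟩ := H
  refine ⟨B + Multiset.replicate (n' - n) 0, by simp [hB, hn], fun x hx => ?_⟩
  rw [Multiset.map_add, Multiset.prod_add]
  exact ((pow_dvd_pow _ hh).trans (H x hx)).mul_right _

theorem HasSpread.mono {p : ℕ} {E : Set ℤ} {n n' h h' : ℕ} (H : HasSpread p E n h) (hn : n' ≤ n)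
    (hh : h ≤ h') : HasSpread p E n' h' := by
  obtain ⟨A, hA, hc, H⟩ := H
  obtain ⟨A', hA', hc'⟩ := Finset.exists_subset_card_eq (hc ▸ hn)
  refine ⟨A', (Finset.coe_subset.2 hA').trans hA, hc', fun a ha hd => H a (hA' ha) ?_⟩
  exact ((pow_dvd_pow _ (by omega)).trans hd).trans
    (Finset.prod_dvd_prod_of_subset _ _ _ (Finset.erase_subset_erase _ hA'))

theorem hasSpread_zero (p : ℕ) (E : Set ℤ) (h : ℕ) : HasSpread p E 0 h :=
  ⟨∅, by simp, rfl, by simp⟩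

theorem HasRoots.union {p : ℕ} {E F : Set ℤ} {n m h : ℕ} (H : HasRoots p E n h)
    (H' : HasRoots p F m h) : HasRoots p (E ∪ F) (n + m) h := by
  obtain ⟨B, hB, H⟩ := H
  obtain ⟨B', hB', H'⟩ := H'
  refine ⟨B + B', by simp [hB, hB'], fun x hx => ?_⟩
  rw [Multiset.map_add, Multiset.prod_add]
  rcases hx with hx | hx
  · exact (H x hx).mul_right _
  · exact (H' x hx).mul_left _

/-- The extra factors a - b with b in `A'` are coprime to p, so they do not change the valuation of
the product. -/
theorem not_pow_dvd_prod_erase_union {p : ℕ} (hp : p.Prime) {A A' : Finset ℤ}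
    (hd : ∀ x ∈ A, ∀ y ∈ A', ¬ (p : ℤ) ∣ x - y) {h : ℕ} {a : ℤ} (ha : a ∈ A)
    (H : ¬ (p : ℤ) ^ h ∣ ∏ b ∈ A.erase a, (a - b)) :
    ¬ (p : ℤ) ^ h ∣ ∏ b ∈ (A ∪ A').erase a, (a - b) := by
  have ha' : a ∉ A' := fun h' => hd a ha a h' (by simp)
  have hdis : Disjoint (A.erase a) A' := by
    rw [Finset.disjoint_left]
    intro x hx hx'
    exact hd x (Finset.mem_of_mem_erase hx) x hx' (by simp)
  rw [Finset.erase_union_distrib, Finset.erase_eq_of_notMem ha', Finset.prod_union hdis]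
  intro h'
  refine H (IsCoprime.dvd_of_dvd_mul_right (IsCoprime.pow_left ?_) h')
  refine IsCoprime.prod_right fun y hy => ?_
  exact ((Nat.prime_iff_prime_int.1 hp).coprime_iff_not_dvd).2 (hd a ha y hy)

theorem HasSpread.union {p : ℕ} (hp : p.Prime) {E F : Set ℤ}
    (hd : ∀ x ∈ E, ∀ y ∈ F, ¬ (p : ℤ) ∣ x - y) {n m h : ℕ} (H : HasSpread p E n h)
    (H' : HasSpread p F m h) : HasSpread p (E ∪ F) (n + m) h := by
  obtain ⟨A, hA, hc, H⟩ := H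
  obtain ⟨A', hA', hc', H'⟩ := H'
  refine ⟨A ∪ A', ?_, ?_, ?_⟩
  · rw [Finset.coe_union]
    exact Set.union_subset_union hA hA'
  · rw [Finset.card_union_of_disjoint, hc, hc']
    rw [Finset.disjoint_left]
    exact fun x hx hx' => hd x (hA hx) x (hA' hx') (by simp)
  · intro a ha
    rcases Finset.mem_union.1 ha with ha | ha
    · exact not_pow_dvd_prod_erase_union hp (fun x hx y hy => hd x (hA hx) y (hA' hy)) ha (H a ha)
    · rw [Finset.union_comm]
      refine not_pow_dvd_prod_erase_union hp (fun x hx y hy h' => ?_) ha (H' a ha)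
      exact hd y (hA hy) x (hA' hx) ((dvd_sub_comm).1 h')

theorem HasGrowth.union {p : ℕ} (hp : p.Prime) {E F : Set ℤ} {K L : ℝ}
    (hd : ∀ x ∈ E, ∀ y ∈ F, ¬ (p : ℤ) ∣ x - y) (H : HasGrowth p E K) (H' : HasGrowth p F L) :
    HasGrowth p (E ∪ F) (K + L) := by
  refine ⟨fun M hM => ?_, fun M hM => ?_⟩
  · obtain ⟨C, hC0, hC⟩ := H.1 (K + (M - (K + L)) / 2) (by linarith)
    obtain ⟨D, hD0, hD⟩ := H'.1 (L + (M - (K + L)) / 2) (by linarith)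
    refine ⟨C + D, add_nonneg hC0 hD0, fun h => ?_⟩
    obtain ⟨n, hn, hn'⟩ := hC h
    obtain ⟨m, hm, hm'⟩ := hD h
    refine ⟨n + m, ?_, hn'.union hm'⟩
    push_cast
    linarith
  · obtain ⟨C, hC0, hC⟩ := H.2 (K + (M - (K + L)) / 2) (by linarith)
    obtain ⟨D, hD0, hD⟩ := H'.2 (L + (M - (K + L)) / 2) (by linarith)
    refine ⟨C + D, add_nonneg hC0 hD0, fun h => ?_⟩
    obtain ⟨n, hn, hn'⟩ := hC h
    obtain ⟨m, hm, hm'⟩ := hD h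
    refine ⟨n + m, ?_, hn'.union hp hd hm'⟩
    push_cast
    linarith

theorem hasGrowth_empty (p : ℕ) : HasGrowth p ∅ 0 := by
  refine ⟨fun K hK => ⟨0, le_rfl, fun h => ⟨0, ?_, 0, rfl, by simp⟩⟩,
    fun K hK => ⟨0, le_rfl, fun h => ⟨0, ?_, hasSpread_zero _ _ _⟩⟩⟩
  · have := mul_nonneg hK.le (Nat.cast_nonneg (α := ℝ) h)
    simpa using this
  · have := mul_nonpos_of_nonpos_of_nonneg hK.le (Nat.cast_nonneg (α := ℝ) h)
    simpa using this

theorem HasGrowth.biUnion {p : ℕ} (hp : p.Prime) {E : ℕ → Set ℤ} {K : ℕ → ℝ} (s : Finset ℕ)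
    (hd : ∀ i ∈ s, ∀ j ∈ s, i ≠ j → ∀ x ∈ E i, ∀ y ∈ E j, ¬ (p : ℤ) ∣ x - y)
    (H : ∀ i ∈ s, HasGrowth p (E i) (K i)) : HasGrowth p (⋃ i ∈ s, E i) (∑ i ∈ s, K i) := by
  induction s using Finset.induction_on with
  | empty => simpa using hasGrowth_empty p
  | insert a s ha ih =>
    rw [Finset.sum_insert ha, Finset.set_biUnion_insert]
    refine HasGrowth.union hp ?_ (H a (by simp)) (ih (fun i hi j hj => hd i (by simp [hi]) j
      (by simp [hj])) fun i hi => H i (by simp [hi]))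
    intro x hx y hy
    obtain ⟨j, hj, hy⟩ := Set.mem_iUnion₂.1 hy
    exact hd a (by simp) j (by simp [hj]) (by rintro rfl; exact ha hj) x hx y hy

/-! ### Growth rates under x ↦ j + p * x -/

theorem HasRoots.image {p : ℕ} {E : Set ℤ} {n h : ℕ} (j : ℤ) (H : HasRoots p E n h) :
    HasRoots p ((fun x => j + (p : ℤ) * x) '' E) n (h + n) := by
  obtain ⟨B, rfl, H⟩ := H
  refine ⟨B.map (fun x => j + (p : ℤ) * x), by simp, ?_⟩
  rintro _ ⟨x, hx, rfl⟩
  have : (fun b : ℤ => j + (p : ℤ) * x - (j + (p : ℤ) * b)) = fun b => (p : ℤ) * (x - b) := by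
    funext b; ring
  rw [Multiset.map_map, Function.comp_def, this, Multiset.prod_map_mul, Multiset.map_const',
    Multiset.prod_replicate, pow_add, mul_comm]
  exact mul_dvd_mul_left _ (H x hx)

/-- Each product has one factor fewer than there are points, so the valuation rises by only n - 1;
the weaker bound h + n avoids truncated subtraction. -/
theorem HasSpread.image {p : ℕ} (hp : p.Prime) {E : Set ℤ} {n h : ℕ} (j : ℤ)
    (H : HasSpread p E n h) : HasSpread p ((fun x => j + (p : ℤ) * x) '' E) n (h + n) := by
  obtain ⟨A, hA, rfl, H⟩ := H
  have hp0 : (p : ℤ) ≠ 0 := by exact_mod_cast hp.ne_zero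
  have hinj : Function.Injective (fun x : ℤ => j + (p : ℤ) * x) := by
    intro x y hxy
    exact mul_left_cancel₀ hp0 (add_left_cancel hxy)
  refine ⟨A.image (fun x => j + (p : ℤ) * x), ?_, Finset.card_image_of_injective _ hinj, ?_⟩
  · rw [Finset.coe_image]
    exact Set.image_mono hA
  · intro a ha hdvd
    obtain ⟨a, ha', rfl⟩ := Finset.mem_image.1 ha
    refine H a ha' ?_
    rw [← Finset.image_erase hinj, Finset.prod_image hinj.injOn] at hdvd
    have : ∀ b ∈ A.erase a, j + (p : ℤ) * a - (j + (p : ℤ) * b) = (p : ℤ) * (a - b) := by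
      intro b _; ring
    rw [Finset.prod_congr rfl this, Finset.prod_mul_distrib, Finset.prod_const] at hdvd
    have hle : (A.erase a).card ≤ A.card := Finset.card_le_card (Finset.erase_subset _ _)
    have h2 : (p : ℤ) ^ (A.erase a).card * (p : ℤ) ^ (h + 1) ∣ (p : ℤ) ^ (h + A.card + 1) := by
      rw [← pow_add]
      exact pow_dvd_pow _ (by omega)
    exact (mul_dvd_mul_iff_left (pow_ne_zero _ hp0)).1 (h2.trans hdvd)

/-- If n is about K * h, the new exponent t = h + n is about (1 + K) * h, so n is about K / (1 + K)
* t. A rate K' slightly off K leaves room to invert this relation, and the constants absorb the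
rounding. -/
theorem HasGrowth.image {p : ℕ} (hp : p.Prime) {E : Set ℤ} {K : ℝ} (hK : 0 ≤ K) (j : ℤ)
    (H : HasGrowth p E K) : HasGrowth p ((fun x => j + (p : ℤ) * x) '' E) (K / (1 + K)) := by
  have hcont : Filter.Tendsto (fun K : ℝ => K / (1 + K)) (nhds K) (nhds (K / (1 + K))) :=
    (ContinuousAt.div continuousAt_id (by fun_prop) (by simp; linarith))
  refine ⟨fun M hM => ?_, fun M hM => ?_⟩
  · obtain ⟨K', hM', hK'⟩ := ((((hcont.mono_left nhdsWithin_le_nhds).eventually_lt_const hM).and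
      (self_mem_nhdsWithin : Set.Ioi K ∈ nhdsWithin K (Set.Ioi K))).exists)
    have hK' : K < K' := hK'
    have hpos : 0 < 1 + K' := by linarith
    obtain ⟨C, hC0, hC⟩ := H.1 K' hK'
    -- K' pays for rounding t / (1 + K') up, 1 for rounding K' * h up.
    refine ⟨K' + 1 + ⌈C⌉₊, add_nonneg (by linarith) (Nat.cast_nonneg _), fun t => ?_⟩
    obtain ⟨n, hn, hR⟩ := hC ⌈(t : ℝ) / (1 + K')⌉₊
    set h := ⌈(t : ℝ) / (1 + K')⌉₊ with hh
    have h1 : (t : ℝ) / (1 + K') ≤ h := Nat.le_ceil _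
    have h2 : (h : ℝ) < (t : ℝ) / (1 + K') + 1 := Nat.ceil_lt_add_one (by positivity)
    have h3 := Nat.le_ceil (K' * h)
    have h4 : (⌈K' * h⌉₊ : ℝ) < K' * h + 1 := Nat.ceil_lt_add_one (by nlinarith)
    have h5 := Nat.le_ceil C
    have hn' : n ≤ ⌈K' * h⌉₊ + ⌈C⌉₊ := by
      have : (n : ℝ) ≤ (⌈K' * h⌉₊ + ⌈C⌉₊ : ℕ) := by push_cast; linarith
      exact_mod_cast this
    -- Padding with superfluous roots makes n at least K' * h, so that h + n reaches t.
    refine ⟨⌈K' * h⌉₊ + ⌈C⌉₊, ?_, ((hR.mono hn' le_rfl).image j).mono le_rfl ?_⟩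
    · have h6 : K' * h ≤ K' * ((t : ℝ) / (1 + K') + 1) :=
        mul_le_mul_of_nonneg_left h2.le (by linarith)
      have h7 : K' / (1 + K') * t ≤ M * t := mul_le_mul_of_nonneg_right hM'.le (by positivity)
      have h8 : K' * ((t : ℝ) / (1 + K') + 1) = K' / (1 + K') * t + K' := by ring
      push_cast
      linarith
    · have : (t : ℝ) ≤ (h + (⌈K' * h⌉₊ + ⌈C⌉₊) : ℕ) := by
        rw [div_le_iff₀ hpos] at h1
        push_cast
        linarith
      exact_mod_cast this
  · rcases lt_or_ge M 0 with hM0 | hM0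
    · refine ⟨0, le_rfl, fun t => ⟨0, ?_, hasSpread_zero _ _ _⟩⟩
      have := mul_nonpos_of_nonpos_of_nonneg hM0.le (Nat.cast_nonneg (α := ℝ) t)
      simpa using this
    have hKpos : 0 < K := by
      rcases hK.lt_or_eq with h | h
      · exact h
      · rw [← h] at hM; simp at hM; linarith
    obtain ⟨K', ⟨hM', hK'⟩, hK0⟩ :=
      ((((hcont.mono_left nhdsWithin_le_nhds).eventually_const_lt hM).and
      (self_mem_nhdsWithin : Set.Iio K ∈ nhdsWithin K (Set.Iio K))).and
      (nhdsWithin_le_nhds (lt_mem_nhds hKpos))).exists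
    have hK' : K' < K := hK'
    have hpos : 0 < 1 + K' := by linarith
    obtain ⟨C, hC0, hC⟩ := H.2 K' hK'
    refine ⟨K' + 1 + C, by positivity, fun t => ?_⟩
    obtain ⟨n, hn, hR⟩ := hC ⌊(t : ℝ) / (1 + K')⌋₊
    set h := ⌊(t : ℝ) / (1 + K')⌋₊ with hh
    have h1 : (h : ℝ) ≤ (t : ℝ) / (1 + K') := Nat.floor_le (by positivity)
    have h2 : (t : ℝ) / (1 + K') < h + 1 := Nat.lt_floor_add_one _
    have h3 : (⌊K' * h⌋₊ : ℝ) ≤ K' * h := Nat.floor_le (by positivity)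
    have h4 := Nat.lt_floor_add_one (K' * h)
    -- Discarding points keeps h + n at most t.
    refine ⟨min n ⌊K' * h⌋₊, ?_, ((hR.mono (min_le_left _ _) le_rfl).image hp j).mono le_rfl ?_⟩
    · have h6 : K' * ((t : ℝ) / (1 + K') - 1) ≤ K' * h :=
        mul_le_mul_of_nonneg_left (by linarith) (by linarith)
      have h7 : M * t ≤ K' / (1 + K') * t := mul_le_mul_of_nonneg_right hM'.le (by positivity)
      have h8 : K' * ((t : ℝ) / (1 + K') - 1) = K' / (1 + K') * t - K' := by ring
      rw [Nat.cast_min]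
      exact le_min (by linarith) (by linarith)
    · have h9 : h + ⌊K' * h⌋₊ ≤ t := by
        have : ((h + ⌊K' * h⌋₊ : ℕ) : ℝ) ≤ t := by
          rw [le_div_iff₀ hpos] at h1
          push_cast
          linarith
        exact_mod_cast this
      exact (Nat.add_le_add_left (min_le_right _ _) _).trans h9

/-! ### The growth rate of ℤ -/

theorem sub_one_mul_padicValNat_factorial_prime_pow {p : ℕ} (hp : p.Prime) (k : ℕ) :
    (p - 1) * padicValNat p (p ^ k).factorial = p ^ k - 1 := by
  have := Fact.mk hp
  induction k with
  | zero => simp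
  | succ k ih =>
    rw [pow_succ', padicValNat_factorial_mul, mul_add, ih, Nat.sub_mul, one_mul]
    have := Nat.pow_pos hp.pos (n := k)
    have : p ^ k ≤ p * p ^ k := Nat.le_mul_of_pos_left _ hp.pos
    omega

/-- A product of p ^ k consecutive integers is divisible by (p ^ k)!. Repeating one block j times is
wasteful, but asymptotically good enough once k is large. -/
theorem hasRoots_univ_block {p : ℕ} (k j : ℕ) :
    HasRoots p Set.univ (j * p ^ k) (j * padicValNat p (p ^ k).factorial) := by
  refine ⟨j • (Multiset.range (p ^ k)).map (fun i => -(i : ℤ)), by simp, fun x _ => ?_⟩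
  rw [Multiset.map_nsmul, Multiset.prod_nsmul, mul_comm j, pow_mul]
  refine pow_dvd_pow_of_dvd ?_ _
  have h1 : (p : ℤ) ^ padicValNat p (p ^ k).factorial ∣ ((p ^ k).factorial : ℤ) := by
    exact_mod_cast pow_padicValNat_dvd
  refine h1.trans ((Nat.factorial_coe_dvd_prod (p ^ k) x).trans (dvd_of_eq ?_))
  rw [Multiset.map_map]
  simp [Finset.prod]

/-- Up to sign the product is i! * (n - 1 - i)!. -/
theorem prod_erase_range_dvd_factorial {n i : ℕ} (hi : i ∈ Finset.range n) :
    (∏ b ∈ (Finset.range n).erase i, ((i : ℤ) - b)) ∣ ((n - 1).factorial : ℤ) := by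
  rw [Finset.mem_range] at hi
  have hsplit : (Finset.range n).erase i = Finset.range i ∪ Finset.Ico (i + 1) n := by
    ext x; simp; omega
  have hdis : Disjoint (Finset.range i) (Finset.Ico (i + 1) n) := by
    rw [Finset.disjoint_left]; intro x; simp; omega
  have h1 : ∏ b ∈ Finset.range i, ((i : ℤ) - b) = (i.factorial : ℤ) := by
    rw [← Finset.prod_range_reflect, ← Finset.prod_range_add_one_eq_factorial]
    push_cast
    refine Finset.prod_congr rfl fun x hx => ?_
    rw [Finset.mem_range] at hx
    have : ((i - 1 - x : ℕ) : ℤ) = i - 1 - x := by omega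
    rw [this]; ring
  have h2 : ∏ b ∈ Finset.Ico (i + 1) n, ((i : ℤ) - b) =
      (-1) ^ (n - 1 - i) * ((n - 1 - i).factorial : ℤ) := by
    have hn : n - (i + 1) = n - 1 - i := by omega
    rw [Finset.prod_Ico_eq_prod_range, hn, ← Finset.prod_range_add_one_eq_factorial]
    conv_rhs => rw [← Finset.card_range (n - 1 - i), ← Finset.prod_const]
    push_cast
    rw [Finset.card_range, ← Finset.prod_mul_distrib]
    refine Finset.prod_congr rfl fun x hx => ?_
    ring
  rw [hsplit, Finset.prod_union hdis, h1, h2, mul_left_comm]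
  rw [IsUnit.mul_left_dvd (by simp [isUnit_neg_one.pow])]
  have h3 := Nat.factorial_mul_factorial_dvd_factorial (n := n - 1) (k := i) (by omega)
  exact_mod_cast h3

/-- The points are 0, ..., n - 1. By Legendre's formula (p - 1) * v((n - 1)!) ≤ n - 1 = (p - 1) * h.
-/
theorem hasSpread_univ {p : ℕ} (hp : p.Prime) (h : ℕ) :
    HasSpread p Set.univ ((p - 1) * h + 1) h := by
  have := Fact.mk hp
  set n := (p - 1) * h + 1 with hn
  refine ⟨(Finset.range n).map Nat.castEmbedding, by simp, by simp, ?_⟩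
  intro a ha hdvd
  obtain ⟨i, hi, rfl⟩ := Finset.mem_map.1 ha
  rw [← Finset.map_erase, Finset.prod_map] at hdvd
  have h1 : p ^ (h + 1) ∣ (n - 1).factorial := by
    have := hdvd.trans (prod_erase_range_dvd_factorial hi)
    exact_mod_cast this
  rw [padicValNat_dvd_iff_le (Nat.factorial_ne_zero _)] at h1
  have h2 := sub_one_mul_padicValNat_factorial (p := p) (n - 1)
  have h3 : (p - 1) * padicValNat p (n - 1).factorial ≤ (p - 1) * h := by
    rw [h2]; omega
  have := Nat.le_of_mul_le_mul_left h3 (by have := hp.two_le; omega)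
  omega

theorem hasGrowth_univ {p : ℕ} (hp : p.Prime) : HasGrowth p Set.univ ((p : ℝ) - 1) := by
  have hp1 : (1 : ℝ) < p := by exact_mod_cast hp.one_lt
  refine ⟨fun K hK => ?_, fun K hK => ⟨0, le_rfl, fun h => ⟨_, ?_, hasSpread_univ hp h⟩⟩⟩
  -- Since K > p - 1, some k has p - 1 < K * (1 - p ^ (-k)); this says that a block spends at most K
  -- roots per unit of valuation.
  · have hlim : Filter.Tendsto (fun k : ℕ => K * (1 - ((p : ℝ)⁻¹) ^ k)) Filter.atTop
        (nhds (K * (1 - 0))) :=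
      (tendsto_const_nhds.sub (tendsto_pow_atTop_nhds_zero_of_lt_one (by positivity)
        (inv_lt_one_of_one_lt₀ hp1))).const_mul K
    rw [sub_zero, mul_one] at hlim
    obtain ⟨k, hk, hk1⟩ := ((hlim.eventually_const_lt hK).and
      (Filter.eventually_ge_atTop 1)).exists
    have hq0 : (0 : ℝ) < (p : ℝ) ^ k := by positivity
    have hM := sub_one_mul_padicValNat_factorial_prime_pow hp k
    set M := padicValNat p (p ^ k).factorial
    have hMR : ((p : ℝ) - 1) * M = (p : ℝ) ^ k - 1 := by
      have h1 : 1 ≤ p ^ k := Nat.pow_pos hp.pos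
      have := congrArg (Nat.cast : ℕ → ℝ) hM
      rw [Nat.cast_mul, Nat.cast_sub hp.one_lt.le, Nat.cast_sub h1] at this
      push_cast at this
      exact this
    have hMpos : (0 : ℝ) < M := by
      have : (0 : ℝ) < ((p : ℝ) - 1) * M := by
        rw [hMR]
        have := one_lt_pow₀ hp1 (by omega : k ≠ 0)
        linarith
      exact pos_of_mul_pos_right this (by linarith)
    have hKM : (p : ℝ) ^ k ≤ K * M := by
      have h1 : (p : ℝ) ^ k * ((p : ℝ) - 1) ≤ K * ((p : ℝ) ^ k - 1) := by
        have h2 : (p : ℝ) ^ k * (K * (1 - ((p : ℝ)⁻¹) ^ k)) = K * ((p : ℝ) ^ k - 1) := by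
          rw [inv_pow]; field_simp
        rw [← h2]
        exact mul_le_mul_of_nonneg_left hk.le hq0.le
      rw [← hMR] at h1
      nlinarith
    refine ⟨(p : ℝ) ^ k, hq0.le, fun h => ⟨⌈(h : ℝ) / M⌉₊ * p ^ k, ?_,
      (hasRoots_univ_block k ⌈(h : ℝ) / M⌉₊).mono le_rfl ?_⟩⟩
    · have h1 : (⌈(h : ℝ) / M⌉₊ : ℝ) < (h : ℝ) / M + 1 := Nat.ceil_lt_add_one (by positivity)
      have h2 : (h : ℝ) / M * (p : ℝ) ^ k ≤ K * h := by
        rw [div_mul_eq_mul_div, div_le_iff₀ hMpos]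
        have := mul_le_mul_of_nonneg_left hKM (Nat.cast_nonneg (α := ℝ) h)
        linarith
      push_cast
      nlinarith
    · have h1 := Nat.le_ceil ((h : ℝ) / M)
      rw [div_le_iff₀ hMpos] at h1
      exact_mod_cast h1
  · have h1 : (1 : ℕ) ≤ p := hp.one_lt.le
    push_cast [h1]
    have := mul_le_mul_of_nonneg_right hK.le (Nat.cast_nonneg (α := ℝ) h)
    linarith

/-! ### From growth rates to the capacity -/

open Polynomial in
theorem HasRoots.exists_mem_characteristicIdeal {p : ℕ} (hp : p.Prime) {E : Set ℤ} {n h : ℕ}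
    (H : HasRoots p E n h) :
    ∃ c ∈ characteristicIdeal E n, c ≠ 0 ∧ padicValRat p c = -(h : ℤ) := by
  have := Fact.mk hp
  have hp0 : (p : ℚ) ≠ 0 := by exact_mod_cast hp.ne_zero
  obtain ⟨B, rfl, H⟩ := H
  set f : ℚ[X] := (B.map fun b : ℤ => X - C (b : ℚ)).prod with hf
  have hmonic : f.Monic := monic_multiset_prod_of_monic _ _ fun b _ => monic_X_sub_C _
  have hdeg : f.natDegree = B.card := by
    have := natDegree_multiset_prod_X_sub_C_eq_card (B.map fun b : ℤ => (b : ℚ))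
    rwa [Multiset.map_map, Multiset.card_map] at this
  have heval : ∀ x : ℤ, f.eval (x : ℚ) = ((B.map (fun b => x - b)).prod : ℤ) := by
    intro x
    rw [hf, eval_multiset_prod, Multiset.map_map, Int.cast_multiset_prod, Multiset.map_map]
    simp
  have hc : ((p : ℚ) ^ h)⁻¹ ≠ 0 := inv_ne_zero (pow_ne_zero _ hp0)
  refine ⟨((p : ℚ) ^ h)⁻¹, ⟨C ((p : ℚ) ^ h)⁻¹ * f, fun a ha => ?_, ?_, ?_⟩, hc, ?_⟩
  · obtain ⟨z, hz⟩ := H a ha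
    refine ⟨z, ?_⟩
    rw [eval_mul, eval_C, heval, hz]
    push_cast
    rw [inv_mul_cancel_left₀ (pow_ne_zero _ hp0)]
  · rw [natDegree_C_mul hc, hdeg]
  · rw [leadingCoeff_mul, leadingCoeff_C, hmonic.leadingCoeff, mul_one]
  · rw [padicValRat.inv, padicValRat.pow]
    simp [hp.one_lt]

theorem padicNorm_intCast_div_le {p : ℕ} (hp : p.Prime) {h : ℕ} {z D : ℤ}
    (hD : ¬ (p : ℤ) ^ (h + 1) ∣ D) : padicNorm p ((z : ℚ) / D) ≤ (p : ℚ) ^ h := by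
  have := Fact.mk hp
  have hp0 : (p : ℚ) ≠ 0 := by exact_mod_cast hp.ne_zero
  have hp1 : (1 : ℚ) < p := by exact_mod_cast hp.one_lt
  have hD0 : (D : ℚ) ≠ 0 := by
    rintro h0
    rw [Int.cast_eq_zero] at h0
    simp [h0] at hD
  have h1 : ¬ padicNorm p (D : ℚ) ≤ (p : ℚ) ^ (-((h + 1 : ℕ) : ℤ)) := by
    rw [← padicNorm.dvd_iff_norm_le]
    exact_mod_cast hD
  have h2 : ((p : ℚ) ^ h)⁻¹ ≤ padicNorm p (D : ℚ) := by
    rw [padicNorm.eq_zpow_of_nonzero hD0, not_le] at h1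
    rw [padicNorm.eq_zpow_of_nonzero hD0]
    rw [zpow_lt_zpow_iff_right₀ hp1] at h1
    rw [← zpow_natCast, ← zpow_neg, zpow_le_zpow_iff_right₀ hp1]
    push_cast at h1
    omega
  rw [padicNorm.div]
  have h3 : padicNorm p (z : ℚ) ≤ 1 := padicNorm.of_int z
  have h4 : (0 : ℚ) < ((p : ℚ) ^ h)⁻¹ := by positivity
  rw [div_le_iff₀ (h4.trans_le h2)]
  calc padicNorm p (z : ℚ) ≤ (p : ℚ) ^ h * ((p : ℚ) ^ h)⁻¹ := by
        rwa [mul_inv_cancel₀ (pow_ne_zero _ hp0)]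
    _ ≤ _ := mul_le_mul_of_nonneg_left h2 (by positivity)

-- The leading coefficient is the sum over a in A of g(a) / ∏ (a - b), with integral g(a); the
-- ultrametric inequality bounds its norm by p ^ h.
open Polynomial in
theorem HasSpread.neg_le_padicValRat {p : ℕ} (hp : p.Prime) {E : Set ℤ} {n h : ℕ}
    (H : HasSpread p E (n + 1) h) {c : ℚ} (hc : c ∈ characteristicIdeal E n) (hc0 : c ≠ 0) :
    -(h : ℤ) ≤ padicValRat p c := by
  have := Fact.mk hp
  have hp1 : (1 : ℚ) < p := by exact_mod_cast hp.one_lt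
  obtain ⟨A, hA, hcard, H⟩ := H
  obtain ⟨f, hf, hfn, rfl⟩ := hc
  -- Multiplying by a power of X makes the degree exactly n, as interpolation at n + 1 points
  -- requires, and keeps the leading coefficient.
  set g : ℚ[X] := f * X ^ (n - f.natDegree) with hg
  have hgE : g ∈ intValuedPolynomials E :=
    Subring.mul_mem _ hf (Subring.pow_mem _ (X_mem_intValuedPolynomials E) _)
  have hf0 : f ≠ 0 := leadingCoeff_ne_zero.1 hc0
  have hgdeg : g.natDegree = n := by
    rw [hg, natDegree_mul_X_pow _ hf0]
    omega
  have hcoeff : g.coeff n = f.leadingCoeff := by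
    rw [hg, coeff_mul_X_pow', if_pos (Nat.sub_le _ _), Nat.sub_sub_self hfn, leadingCoeff]
  have hlag := Lagrange.coeff_eq_sum (s := A) (v := fun a : ℤ => (a : ℚ)) (P := g)
    Int.cast_injective.injOn
    (lt_of_le_of_lt degree_le_natDegree (by rw [hgdeg, hcard]; exact_mod_cast Nat.lt_succ_self n))
  rw [hcard, Nat.add_sub_cancel, hcoeff] at hlag
  have hle : padicNorm p f.leadingCoeff ≤ (p : ℚ) ^ h := by
    rw [hlag]
    refine padicNorm.sum_le' (fun a ha => ?_) (by positivity)
    obtain ⟨z, hz⟩ := hgE a (hA ha)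
    have hprod : ∏ b ∈ A.erase a, ((a : ℚ) - (b : ℚ)) = ((∏ b ∈ A.erase a, (a - b) : ℤ) : ℚ) := by
      push_cast
      rfl
    rw [hz, hprod]
    exact padicNorm_intCast_div_le hp (H a ha)
  rw [padicNorm.eq_zpow_of_nonzero hc0, ← zpow_natCast, zpow_le_zpow_iff_right₀ hp1] at hle
  omega

theorem exists_isCharacteristicSequence {p : ℕ} {E : Set ℤ}
    (H : ∀ n, ∃ b : ℤ, ∀ c ∈ characteristicIdeal E n, c ≠ 0 → b ≤ padicValRat p c) :
    ∃ α, IsCharacteristicSequence p E α := by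
  have key : ∀ n, ∃ a : ℤ,
      IsLeast {v : ℤ | ∃ c ∈ characteristicIdeal E n, c ≠ 0 ∧ padicValRat p c = v} (-a) := by
    intro n
    obtain ⟨b, hb⟩ := H n
    obtain ⟨v, hv, hmin⟩ := Int.exists_least_of_bdd
      (P := fun v => ∃ c ∈ characteristicIdeal E n, c ≠ 0 ∧ padicValRat p c = v)
      ⟨b, by rintro _ ⟨c, hc, hc0, rfl⟩; exact hb c hc hc0⟩
      -- The constant polynomial 1 shows that the set of valuations is nonempty.
      ⟨0, 1, ⟨1, Subring.one_mem _, by simp, by simp⟩, one_ne_zero, by simp⟩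
    exact ⟨-v, by rw [neg_neg]; exact ⟨hv, fun w hw => hmin w hw⟩⟩
  choose α hα using key
  exact ⟨α, hα⟩

theorem HasGrowth.hasValuativeCapacity {p : ℕ} (hp : p.Prime) {E : Set ℤ} {K : ℝ} (hK : 0 < K)
    (H : HasGrowth p E K) : HasValuativeCapacity p E (1 / K) := by
  have hspread : ∀ n, ∃ h, HasSpread p E (n + 1) h := by
    intro n
    obtain ⟨C, hC0, hC⟩ := H.2 (K / 2) (by linarith)
    obtain ⟨m, hm, hm'⟩ := hC ⌈(n + 1 + C) / (K / 2)⌉₊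
    refine ⟨_, hm'.mono ?_ le_rfl⟩
    have h1 := Nat.le_ceil ((n + 1 + C) / (K / 2))
    rw [div_le_iff₀ (by linarith)] at h1
    have : ((n + 1 : ℕ) : ℝ) ≤ m := by push_cast; linarith
    exact_mod_cast this
  obtain ⟨α, hα⟩ := exists_isCharacteristicSequence (p := p) (E := E) fun n => by
    obtain ⟨h, hh⟩ := hspread n
    exact ⟨-h, fun c hc hc0 => hh.neg_le_padicValRat hp hc hc0⟩
  refine ⟨α, hα, ?_⟩
  have hlow : ∀ n h : ℕ, HasRoots p E n h → (h : ℤ) ≤ α n := by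
    intro n h hr
    have := (hα n).2 (hr.exists_mem_characteristicIdeal hp)
    omega
  have hupp : ∀ n h : ℕ, HasSpread p E (n + 1) h → α n ≤ h := by
    intro n h hs
    obtain ⟨c, hc, hc0, hv⟩ := (hα n).1
    have := hs.neg_le_padicValRat hp hc hc0
    omega
  have hinv : Filter.Tendsto (fun K : ℝ => 1 / K) (nhds K) (nhds (1 / K)) :=
    tendsto_const_nhds.div Filter.tendsto_id hK.ne'
  have hlim : ∀ a b : ℝ, Filter.Tendsto (fun n : ℕ => a + b / (n : ℝ)) Filter.atTop (nhds a) := by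
    intro a b
    simpa using (tendsto_const_div_atTop_nhds_zero_nat b).const_add a
  refine tendsto_order.2 ⟨fun a ha => ?_, fun a ha => ?_⟩
  · obtain ⟨K', haK, hK'⟩ := (((hinv.mono_left nhdsWithin_le_nhds).eventually_const_lt ha).and
      (self_mem_nhdsWithin : Set.Ioi K ∈ nhdsWithin K (Set.Ioi K))).exists
    have hK' : K < K' := hK'
    have hpos : 0 < K' := hK.trans hK'
    obtain ⟨C, hC0, hC⟩ := H.1 K' hK'
    filter_upwards [(hlim (1 / K') (-(C / K' + 1))).eventually_const_lt haK,
      Filter.eventually_ge_atTop (⌈C⌉₊ + 1)] with n hn hnC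
    have hnC' : C ≤ n := (Nat.le_ceil C).trans (by exact_mod_cast (by omega : ⌈C⌉₊ ≤ n))
    have hn0 : (0 : ℝ) < n := by exact_mod_cast (by omega : 0 < n)
    -- The largest h with K' * h + C ≤ n, so that n roots suffice for p ^ h.
    obtain ⟨m, hm, hm'⟩ := hC ⌊(n - C) / K'⌋₊
    have h1 := Nat.floor_le (a := ((n : ℝ) - C) / K') (div_nonneg (by linarith) hpos.le)
    have h2 := Nat.lt_floor_add_one (((n : ℝ) - C) / K')
    have hmn : m ≤ n := by
      rw [le_div_iff₀ hpos] at h1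
      have : (m : ℝ) ≤ n := by linarith
      exact_mod_cast this
    have h3 : ((⌊(n - C) / K'⌋₊ : ℤ) : ℝ) ≤ α n := by exact_mod_cast hlow n _ (hm'.mono hmn le_rfl)
    rw [Int.cast_natCast] at h3
    refine hn.trans_le ?_
    rw [le_div_iff₀ hn0, add_mul, div_mul_cancel₀ _ hn0.ne']
    have h4 : ((n : ℝ) - C) / K' = 1 / K' * n - C / K' := by ring
    linarith
  · obtain ⟨K', ⟨haK, hK'⟩, hpos⟩ := (((hinv.mono_left nhdsWithin_le_nhds).eventually_lt_const ha).and
      (self_mem_nhdsWithin : Set.Iio K ∈ nhdsWithin K (Set.Iio K))).and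
      (nhdsWithin_le_nhds (lt_mem_nhds hK)) |>.exists
    have hK' : K' < K := hK'
    obtain ⟨C, hC0, hC⟩ := H.2 K' hK'
    filter_upwards [(hlim (1 / K') ((1 + C) / K' + 1)).eventually_lt_const haK,
      Filter.eventually_ge_atTop 1] with n hn hn1
    have hn0 : (0 : ℝ) < n := by exact_mod_cast hn1
    -- The least h with K' * h - C ≥ n + 1, which provides the n + 1 interpolation points.
    obtain ⟨m, hm, hm'⟩ := hC ⌈(n + 1 + C) / K'⌉₊
    have h1 := Nat.le_ceil (((n : ℝ) + 1 + C) / K')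
    have h2 := Nat.ceil_lt_add_one (a := ((n : ℝ) + 1 + C) / K') (by positivity)
    have hmn : n + 1 ≤ m := by
      rw [div_le_iff₀ hpos] at h1
      have : ((n + 1 : ℕ) : ℝ) ≤ m := by push_cast; linarith
      exact_mod_cast this
    have h3 : (α n : ℝ) ≤ ((⌈(n + 1 + C) / K'⌉₊ : ℤ) : ℝ) := by
      exact_mod_cast hupp n _ (hm'.mono hmn le_rfl)
    rw [Int.cast_natCast] at h3
    refine lt_of_le_of_lt ?_ hn
    rw [div_le_iff₀ hn0, add_mul, div_mul_cancel₀ _ hn0.ne']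
    have h4 : ((n : ℝ) + 1 + C) / K' = 1 / K' * n + (1 + C) / K' := by ring
    linarith

/-! ### The recursion for unions of cosets -/

/-- The reciprocal of the valuative capacity of `cosetUnion p m l`, and `0` for `l = []`. -/
def invCapacity (p : ℕ) : ℕ → List ℤ → ℚ
  | 0, l => if l = [] then 0 else (p : ℚ) - 1
  | m + 1, l => ∑ j ∈ Finset.range p,
      invCapacity p m (residuePart p j l) / (1 + invCapacity p m (residuePart p j l))

theorem residuePart_nil (p j : ℕ) : residuePart p j [] = [] := rfl

theorem invCapacity_nil (p m : ℕ) : invCapacity p m [] = 0 := by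
  induction m with
  | zero => simp [invCapacity]
  | succ m ih => simp [invCapacity, residuePart_nil, ih]

theorem invCapacity_nonneg {p : ℕ} (hp : p.Prime) (m : ℕ) (l : List ℤ) :
    0 ≤ invCapacity p m l := by
  induction m generalizing l with
  | zero =>
    have : (1 : ℚ) ≤ p := by exact_mod_cast hp.one_lt.le
    rw [invCapacity]
    split_ifs <;> linarith
  | succ m ih =>
    rw [invCapacity]
    exact Finset.sum_nonneg fun j _ => div_nonneg (ih _) (add_nonneg zero_le_one (ih _))

theorem mem_residuePart {p j : ℕ} (hp : 0 < p) (hj : j < p) {l : List ℤ} {b : ℤ} :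
    b ∈ residuePart p j l ↔ (j : ℤ) + p * b ∈ l := by
  have hp' : (0 : ℤ) < p := by exact_mod_cast hp
  have hj' : (j : ℤ) < p := by exact_mod_cast hj
  simp only [residuePart, List.mem_map, List.mem_filter, decide_eq_true_eq]
  constructor
  · rintro ⟨a, ⟨ha, hmod⟩, rfl⟩
    rwa [← hmod, Int.emod_add_mul_ediv]
  · intro h
    refine ⟨_, ⟨h, ?_⟩, ?_⟩
    · rw [Int.add_mul_emod_self_left, Int.emod_eq_of_lt (by positivity) hj']
    · rw [Int.add_mul_ediv_left _ _ hp'.ne', Int.ediv_eq_zero_of_lt (by positivity) hj', zero_add]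

theorem invCapacity_pos {p : ℕ} (hp : p.Prime) (m : ℕ) {l : List ℤ} (hl : l ≠ []) :
    0 < invCapacity p m l := by
  induction m generalizing l with
  | zero =>
    have : (1 : ℚ) < p := by exact_mod_cast hp.one_lt
    rw [invCapacity, if_neg hl]
    linarith
  | succ m ih =>
    obtain ⟨a, ha⟩ := List.exists_mem_of_ne_nil _ hl
    have hp' : (0 : ℤ) < p := by exact_mod_cast hp.pos
    obtain ⟨j, hj⟩ := Int.eq_ofNat_of_zero_le (Int.emod_nonneg a hp'.ne')
    have hjp : j < p := by
      have := Int.emod_lt_of_pos a hp'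
      omega
    have hne : residuePart p j l ≠ [] := by
      refine List.ne_nil_of_mem (a := a / p) ((mem_residuePart hp.pos hjp).2 ?_)
      rwa [← hj, Int.emod_add_mul_ediv]
    rw [invCapacity]
    refine Finset.sum_pos' (fun i _ => ?_) ⟨j, Finset.mem_range.2 hjp, ?_⟩
    · have := invCapacity_nonneg hp m (residuePart p i l)
      positivity
    · have := ih hne
      positivity

theorem mem_cosetUnion {p m : ℕ} {l : List ℤ} {x : ℤ} :
    x ∈ cosetUnion p m l ↔ ∃ a ∈ l, (p : ℤ) ^ m ∣ x - a := by
  simp only [cosetUnion, coset, Set.mem_iUnion, Set.mem_ofPred_eq, exists_prop, dvd_def,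
    sub_eq_iff_eq_add']

theorem cosetUnion_succ {p : ℕ} (hp : 0 < p) (m : ℕ) (l : List ℤ) :
    cosetUnion p (m + 1) l = ⋃ j ∈ Finset.range p,
      (fun x => (j : ℤ) + (p : ℤ) * x) '' cosetUnion p m (residuePart p j l) := by
  have hp' : (0 : ℤ) < p := by exact_mod_cast hp
  ext x
  simp only [Set.mem_iUnion, Set.mem_image, mem_cosetUnion, exists_prop, Finset.mem_range]
  constructor
  · rintro ⟨a, ha, k, hk⟩
    obtain ⟨j, hj⟩ := Int.eq_ofNat_of_zero_le (Int.emod_nonneg a hp'.ne')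
    have hjp : j < p := by
      have := Int.emod_lt_of_pos a hp'
      omega
    have ha' := Int.emod_add_mul_ediv a p
    refine ⟨j, hjp, a / p + p ^ m * k, ⟨a / p, (mem_residuePart hp hjp).2 ?_, k, by ring⟩, ?_⟩
    · rwa [← hj, ha']
    · rw [hj] at ha'
      rw [pow_succ] at hk
      linear_combination ha' - hk
  · rintro ⟨j, hjp, y, ⟨a, ha, k, hk⟩, rfl⟩
    refine ⟨_, (mem_residuePart hp hjp).1 ha, k, ?_⟩
    rw [pow_succ]
    linear_combination (p : ℤ) * hk

theorem hasGrowth_cosetUnion {p : ℕ} (hp : p.Prime) (m : ℕ) (l : List ℤ) :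
    HasGrowth p (cosetUnion p m l) (invCapacity p m l : ℝ) := by
  induction m generalizing l with
  | zero =>
    rw [invCapacity]
    split_ifs with hl
    · subst hl
      have : cosetUnion p 0 [] = ∅ := by simp [cosetUnion]
      rw [this, Rat.cast_zero]
      exact hasGrowth_empty p
    · obtain ⟨a, ha⟩ := List.exists_mem_of_ne_nil _ hl
      have : cosetUnion p 0 l = Set.univ :=
        Set.eq_univ_of_forall fun x => mem_cosetUnion.2 ⟨a, ha, by simp⟩
      rw [this]
      push_cast
      exact hasGrowth_univ hp
  | succ m ih =>
    rw [invCapacity, cosetUnion_succ hp.pos]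
    push_cast
    refine HasGrowth.biUnion hp _ ?_ fun j _ => (ih _).image hp ?_ j
    · rintro i hi j hj hij _ ⟨x, -, rfl⟩ _ ⟨y, -, rfl⟩ hdvd
      rw [Finset.mem_range] at hi hj
      have h1 : (p : ℤ) ∣ (i : ℤ) - j := by
        have : (i : ℤ) - j = (i + p * x - (j + p * y)) - p * (x - y) := by ring
        rw [this]
        exact dvd_sub hdvd (dvd_mul_right _ _)
      have h2 := Int.eq_zero_of_abs_lt_dvd h1 (by rw [abs_lt]; constructor <;> omega)
      omega
    · exact_mod_cast invCapacity_nonneg hp m _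

theorem hasValuativeCapacity_cosetUnion {p : ℕ} (hp : p.Prime) (m : ℕ) {l : List ℤ}
    (hl : l ≠ []) : HasValuativeCapacity p (cosetUnion p m l) (((invCapacity p m l)⁻¹ : ℚ) : ℝ) := by
  have hpos : (0 : ℝ) < invCapacity p m l := by exact_mod_cast invCapacity_pos hp m hl
  rw [Rat.cast_inv, ← one_div]
  exact (hasGrowth_cosetUnion hp m l).hasValuativeCapacity hp hpos

/-- Only finitely many residues mod p ^ m occur in A, and they represent all the cosets. -/
theorem IsUnionOfCosets.exists_eq_cosetUnion {p m : ℕ} (hp : 0 < p) {E : Set ℤ}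
    (H : IsUnionOfCosets p m E) : ∃ l, E = cosetUnion p m l := by
  obtain ⟨A, rfl⟩ := H
  have hq : (0 : ℤ) < (p : ℤ) ^ m := by positivity
  have hfin : ((fun a : ℤ => a % (p : ℤ) ^ m) '' A).Finite := by
    refine (Set.finite_Ico (0 : ℤ) ((p : ℤ) ^ m)).subset ?_
    rintro _ ⟨a, -, rfl⟩
    exact ⟨Int.emod_nonneg _ hq.ne', Int.emod_lt_of_pos _ hq⟩
  refine ⟨hfin.toFinset.toList, ?_⟩
  ext x
  simp only [mem_cosetUnion, Set.mem_iUnion, coset, Set.mem_ofPred_eq, exists_prop,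
    Finset.mem_toList, Set.Finite.mem_toFinset, Set.mem_image]
  constructor
  · rintro ⟨a, ha, k, rfl⟩
    refine ⟨_, ⟨a, ha, rfl⟩, a / (p : ℤ) ^ m + k, ?_⟩
    linear_combination -(Int.emod_add_mul_ediv a ((p : ℤ) ^ m))
  · rintro ⟨_, ⟨a, ha, rfl⟩, k, hk⟩
    refine ⟨a, ha, k - a / (p : ℤ) ^ m, ?_⟩
    linear_combination hk + (Int.emod_add_mul_ediv a ((p : ℤ) ^ m))

/-- For K ≠ 0, K / (1 + K) = (1 + K⁻¹)⁻¹; empty residue classes have K = 0 and drop out of the sum.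
-/
theorem inv_invCapacity_succ {p : ℕ} (hp : p.Prime) (m : ℕ) (l : List ℤ) :
    (invCapacity p (m + 1) l)⁻¹ =
      (∑ j ∈ (Finset.range p).filter (fun j => residuePart p j l ≠ []),
        (1 + (invCapacity p m (residuePart p j l))⁻¹)⁻¹)⁻¹ := by
  rw [invCapacity, Finset.sum_filter]
  congr 1
  refine Finset.sum_congr rfl fun j _ => ?_
  split_ifs with h
  · have := invCapacity_pos hp m h
    field_simp
    ring
  · rw [not_not] at h
    rw [h, invCapacity_nil, zero_div]

/-! ### Computability of the capacity -/

/-- The remainder of the integer `a` modulo `q > 0`, in terms of the encoding of `ℤ` in `ℕ`. -/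
def natResidue (a : ℤ) (q : ℕ) : ℕ :=
  if Encodable.encode a % 2 = 0 then Encodable.encode a / 2 % q
  -- An odd code 2 * n + 1 stands for -n - 1, whose residue is q - 1 - n % q.
  else q - 1 - Encodable.encode a / 2 % q

theorem encode_ofNat (n : ℕ) : Encodable.encode (Int.ofNat n) = 2 * n := rfl

theorem encode_negSucc (n : ℕ) : Encodable.encode (Int.negSucc n) = 2 * n + 1 := rfl

theorem natCast_natResidue (a : ℤ) {q : ℕ} (hq : 0 < q) : (natResidue a q : ℤ) = a % q := by
  cases a with
  | ofNat n =>
    have h1 : 2 * n % 2 = 0 := by omega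
    have h2 : 2 * n / 2 = n := by omega
    rw [natResidue, encode_ofNat, if_pos h1, h2]
    simp
  | negSucc n =>
    have h1 : (2 * n + 1) % 2 ≠ 0 := by omega
    have h2 : (2 * n + 1) / 2 = n := by omega
    have h3 : n % q < q := Nat.mod_lt _ hq
    rw [natResidue, encode_negSucc, if_neg h1, h2, Int.negSucc_emod _ (by exact_mod_cast hq)]
    have : ((n % q : ℕ) : ℤ) = n % q := by simp
    omega

theorem primrec₂_natResidue : Primrec₂ natResidue := by
  have he : Primrec fun x : ℤ × ℕ => Encodable.encode x.1 := Primrec.encode.comp Primrec.fst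
  have hd : Primrec fun x : ℤ × ℕ => Encodable.encode x.1 / 2 % x.2 :=
    Primrec.nat_mod.comp (Primrec.nat_div.comp he (Primrec.const 2)) Primrec.snd
  exact Primrec.ite (Primrec.eq.comp (Primrec.nat_mod.comp he (Primrec.const 2)) (Primrec.const 0))
    hd (Primrec.nat_sub.comp (Primrec.nat_sub.comp Primrec.snd (Primrec.const 1)) hd)

theorem primrec₂_nat_pow : Primrec₂ ((· ^ ·) : ℕ → ℕ → ℕ) :=
  Primrec₂.unpaired'.1 Nat.Primrec.pow

theorem primrec_int_ofNat : Primrec Int.ofNat :=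
  Primrec.encode_iff.1 (Primrec.nat_mul.comp (Primrec.const 2) Primrec.id)

/-- The pair representing the sum of the fraction `s` and of `x / (1 + x)`. -/
def addFrac (s x : ℕ × ℕ) : ℕ × ℕ :=
  (s.1 * (x.1 + x.2) + x.1 * s.2, s.2 * (x.1 + x.2))

theorem primrec₂_addFrac : Primrec₂ addFrac := by
  have h1 : Primrec fun y : (ℕ × ℕ) × (ℕ × ℕ) => y.1.1 := Primrec.fst.comp Primrec.fst
  have h2 : Primrec fun y : (ℕ × ℕ) × (ℕ × ℕ) => y.1.2 := Primrec.snd.comp Primrec.fst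
  have h3 : Primrec fun y : (ℕ × ℕ) × (ℕ × ℕ) => y.2.1 := Primrec.fst.comp Primrec.snd
  have h4 : Primrec fun y : (ℕ × ℕ) × (ℕ × ℕ) => y.2.2 := Primrec.snd.comp Primrec.snd
  have h5 := Primrec.nat_add.comp h3 h4
  exact Primrec.pair
    (Primrec.nat_add.comp (Primrec.nat_mul.comp h1 h5) (Primrec.nat_mul.comp h3 h2))
    (Primrec.nat_mul.comp h2 h5)

/-- The pair `y` of a numerator and a positive denominator represents `q`. -/
def Represents (y : ℕ × ℕ) (q : ℚ) : Prop :=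
  0 < y.2 ∧ (y.1 : ℚ) / y.2 = q

theorem Represents.addFrac {s x : ℕ × ℕ} {a b : ℚ} (hs : Represents s a) (hx : Represents x b) :
    Represents (addFrac s x) (a + b / (1 + b)) := by
  obtain ⟨hs, rfl⟩ := hs
  obtain ⟨hx, rfl⟩ := hx
  have h1 : (0 : ℚ) < s.2 := by exact_mod_cast hs
  have h2 : (0 : ℚ) < x.2 := by exact_mod_cast hx
  have h3 : (0 : ℚ) < x.1 + x.2 := by positivity
  have h4 : (0 : ℚ) < 1 + x.1 / x.2 := by positivity
  refine ⟨Nat.mul_pos hs (by omega), ?_⟩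
  simp only [_root_.addFrac]
  push_cast
  have h5 : (x.1 : ℚ) / x.2 / (1 + x.1 / x.2) = x.1 / (x.1 + x.2) := by
    rw [div_div, mul_add, mul_one, mul_div_cancel₀ _ h2.ne', add_comm (x.2 : ℚ)]
  rw [h5]
  field_simp

theorem represents_foldl_addFrac {f : ℕ → ℕ × ℕ} {g : ℕ → ℚ} (n : ℕ)
    (H : ∀ j < n, Represents (f j) (g j)) :
    Represents ((List.range n).foldl (fun s j => addFrac s (f j)) (0, 1))
      (∑ j ∈ Finset.range n, g j / (1 + g j)) := by
  induction n with
  | zero => exact ⟨by simp, by simp⟩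
  | succ n ih =>
    rw [List.range_succ, List.foldl_append, Finset.sum_range_succ]
    exact (ih fun j hj => H j (by omega)).addFrac (H n (by omega))

/-- For each residue `r` modulo `p ^ m`, the fraction representing
`invCapacity p 0 (residuePart (p ^ m) r l)`. -/
def bottomLevel (x : ℕ × ℕ × List ℤ) : List (ℕ × ℕ) :=
  (List.range (x.1 ^ x.2.1)).map fun r =>
    if ∃ a ∈ x.2.2, natResidue a (x.1 ^ x.2.1) = r then (x.1 - 1, 1) else (0, 1)

/-- The fraction representing `∑ x / (1 + x)` over the entries `x` of `t` at the positions
`r + q * j` with `j < p`. -/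
def combineEntries (p q r : ℕ) (t : List (ℕ × ℕ)) : ℕ × ℕ :=
  (List.range p).foldl (fun s j => addFrac s (t.getD (r + q * j) (0, 1))) (0, 1)

/-- The fractions for the residues modulo `p ^ (m - (k + 1))`, from those modulo `p ^ (m - k)`. -/
def nextLevel (x : ℕ × ℕ × List ℤ) (k : ℕ) (t : List (ℕ × ℕ)) : List (ℕ × ℕ) :=
  (List.range (x.1 ^ (x.2.1 - (k + 1)))).map fun r =>
    combineEntries x.1 (x.1 ^ (x.2.1 - (k + 1))) r t

/-- For each residue `r` modulo `p ^ (m - k)`, the fraction representing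
`invCapacity p k (residuePart (p ^ (m - k)) r l)`. -/
def levelTable (x : ℕ × ℕ × List ℤ) (k : ℕ) : List (ℕ × ℕ) :=
  Nat.rec (bottomLevel x) (fun k t => nextLevel x k t) k

theorem primrec_bottomLevel : Primrec bottomLevel := by
  have hrel : PrimrecRel fun (a : ℤ) (y : ℕ × ℕ) => natResidue a y.1 = y.2 :=
    Primrec.eq.comp
      (primrec₂_natResidue.comp Primrec.fst (Primrec.fst.comp Primrec.snd))
      (Primrec.snd.comp Primrec.snd)
  have hex := hrel.exists_mem_list
  have hpow : Primrec fun x : ℕ × ℕ × List ℤ => x.1 ^ x.2.1 :=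
    primrec₂_nat_pow.comp Primrec.fst (Primrec.fst.comp Primrec.snd)
  refine Primrec.list_map (Primrec.list_range.comp hpow) ?_
  refine Primrec.ite (c := fun y : (ℕ × ℕ × List ℤ) × ℕ =>
      ∃ a ∈ y.1.2.2, natResidue a (y.1.1 ^ y.1.2.1) = y.2)
    (hex.comp (Primrec.snd.comp (Primrec.snd.comp Primrec.fst))
      (Primrec.pair (hpow.comp Primrec.fst) Primrec.snd)) ?_ (Primrec.const _)
  exact Primrec.pair (Primrec.nat_sub.comp (Primrec.fst.comp Primrec.fst) (Primrec.const 1))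
    (Primrec.const 1)

theorem primrec_combineEntries : Primrec fun y : ℕ × ℕ × ℕ × List (ℕ × ℕ) =>
    combineEntries y.1 y.2.1 y.2.2.1 y.2.2.2 := by
  have hq : Primrec fun y : ℕ × ℕ × ℕ × List (ℕ × ℕ) => y.2.1 := Primrec.fst.comp Primrec.snd
  have hr : Primrec fun y : ℕ × ℕ × ℕ × List (ℕ × ℕ) => y.2.2.1 :=
    Primrec.fst.comp (Primrec.snd.comp Primrec.snd)
  have ht : Primrec fun y : ℕ × ℕ × ℕ × List (ℕ × ℕ) => y.2.2.2 :=
    Primrec.snd.comp (Primrec.snd.comp Primrec.snd)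
  have hidx : Primrec fun z : (ℕ × ℕ × ℕ × List (ℕ × ℕ)) × (ℕ × ℕ) × ℕ =>
      z.1.2.2.1 + z.1.2.1 * z.2.2 :=
    Primrec.nat_add.comp (hr.comp Primrec.fst)
      (Primrec.nat_mul.comp (hq.comp Primrec.fst) (Primrec.snd.comp Primrec.snd))
  have hstep : Primrec fun z : (ℕ × ℕ × ℕ × List (ℕ × ℕ)) × (ℕ × ℕ) × ℕ =>
      addFrac z.2.1 (z.1.2.2.2.getD (z.1.2.2.1 + z.1.2.1 * z.2.2) (0, 1)) :=
    primrec₂_addFrac.comp (Primrec.fst.comp Primrec.snd)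
      ((Primrec.list_getD _).comp (ht.comp Primrec.fst) hidx)
  exact Primrec.list_foldl (Primrec.list_range.comp Primrec.fst) (Primrec.const _) hstep.to₂

theorem primrec_nextLevel : Primrec fun y : (ℕ × ℕ × List ℤ) × ℕ × List (ℕ × ℕ) =>
    nextLevel y.1 y.2.1 y.2.2 := by
  have hp : Primrec fun y : (ℕ × ℕ × List ℤ) × ℕ × List (ℕ × ℕ) => y.1.1 :=
    Primrec.fst.comp Primrec.fst
  have hpow : Primrec fun y : (ℕ × ℕ × List ℤ) × ℕ × List (ℕ × ℕ) =>
      y.1.1 ^ (y.1.2.1 - (y.2.1 + 1)) :=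
    primrec₂_nat_pow.comp hp (Primrec.nat_sub.comp
      (Primrec.fst.comp (Primrec.snd.comp Primrec.fst))
      (Primrec.succ.comp (Primrec.fst.comp Primrec.snd)))
  have htuple : Primrec fun z : ((ℕ × ℕ × List ℤ) × ℕ × List (ℕ × ℕ)) × ℕ =>
      (z.1.1.1, z.1.1.1 ^ (z.1.1.2.1 - (z.1.2.1 + 1)), z.2, z.1.2.2) :=
    Primrec.pair (hp.comp Primrec.fst) (Primrec.pair (hpow.comp Primrec.fst)
      (Primrec.pair Primrec.snd (Primrec.snd.comp (Primrec.snd.comp Primrec.fst))))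
  have hentry := (primrec_combineEntries.comp htuple).to₂
  exact Primrec.list_map (Primrec.list_range.comp hpow) hentry

theorem primrec₂_levelTable : Primrec₂ levelTable :=
  Primrec.nat_rec primrec_bottomLevel primrec_nextLevel.to₂

theorem getD_map_range {β : Type*} (f : ℕ → β) (d : β) {n r : ℕ} (h : r < n) :
    ((List.range n).map f).getD r d = f r := by
  simp [List.getD, h]

/-- Iterated residue parts are single ones for a higher modulus: the digits r and j combine to r + q
* j. Thus the recursion, which changes the list at each call, only ever meets residue parts of the
original list, and a table suffices. -/
theorem residuePart_residuePart {p q j r : ℕ} (hr : r < q) (l : List ℤ) :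
    residuePart p j (residuePart q r l) = residuePart (q * p) (r + q * j) l := by
  have hq : (0 : ℤ) < q := by exact_mod_cast (Nat.zero_le r).trans_lt hr
  simp only [residuePart, List.filter_map, List.map_map, List.filter_filter]
  have hmap : ((fun a : ℤ => a / (p : ℤ)) ∘ fun a : ℤ => a / (q : ℤ)) =
      fun a : ℤ => a / ((q * p : ℕ) : ℤ) := by
    funext a
    push_cast
    exact Int.ediv_ediv_of_nonneg hq.le
  rw [hmap]
  congr 1
  refine List.filter_congr fun a _ => ?_
  rw [Bool.eq_iff_iff]
  simp only [Function.comp_apply, Bool.and_eq_true, decide_eq_true_eq]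
  have hmod : a % ((q * p : ℕ) : ℤ) = a % q + q * (a / q % p) := by
    have h := congrFun hmap a
    simp only [Function.comp_apply] at h
    have h0 := Int.emod_add_mul_ediv a ((q * p : ℕ) : ℤ)
    rw [← h] at h0
    push_cast at h0 ⊢
    linear_combination h0 - Int.emod_add_mul_ediv a q - q * Int.emod_add_mul_ediv (a / q) p
  have h1 := Int.emod_nonneg a hq.ne'
  have h2 := Int.emod_lt_of_pos a hq
  rw [hmod]
  push_cast
  constructor
  · rintro ⟨h, h'⟩
    rw [h, h']
  · intro h
    have h3 : (q : ℤ) ∣ a % q - r := ⟨j - a / q % p, by linear_combination h⟩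
    have h4 := Int.eq_zero_of_abs_lt_dvd h3 (by rw [abs_lt]; constructor <;> omega)
    refine ⟨mul_left_cancel₀ hq.ne' ?_, by omega⟩
    linear_combination h - h4

theorem represents_levelTable {p : ℕ} (hp : 0 < p) (m : ℕ) (l : List ℤ) {k : ℕ} (hk : k ≤ m)
    {r : ℕ} (hr : r < p ^ (m - k)) :
    Represents ((levelTable (p, m, l) k).getD r (0, 1))
      (invCapacity p k (residuePart (p ^ (m - k)) r l)) := by
  induction k generalizing r with
  | zero =>
    have hq : 0 < p ^ m := Nat.pow_pos hp
    have hiff : (∃ a ∈ l, natResidue a (p ^ m) = r) ↔ ¬ residuePart (p ^ m) r l = [] := by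
      simp only [residuePart, List.map_eq_nil_iff, List.filter_eq_nil_iff, decide_eq_true_eq,
        not_forall, not_not, exists_prop]
      refine exists_congr fun a => and_congr_right fun _ => ?_
      rw [← natCast_natResidue a hq, Nat.cast_inj]
    change Represents ((bottomLevel (p, m, l)).getD r (0, 1)) _
    rw [bottomLevel, getD_map_range _ _ (by simpa using hr)]
    simp only [hiff, invCapacity, Nat.sub_zero]
    by_cases h : residuePart (p ^ m) r l = []
    · simp [h, Represents]
    · simp [h, Represents, Nat.cast_sub (Nat.succ_le_of_lt hp)]
  | succ k ih =>
    change Represents ((nextLevel (p, m, l) k (levelTable (p, m, l) k)).getD r (0, 1)) _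
    rw [nextLevel, getD_map_range _ _ hr, invCapacity]
    refine represents_foldl_addFrac
      (f := fun j => (levelTable (p, m, l) k).getD (r + p ^ (m - (k + 1)) * j) (0, 1)) _
      fun j hj => ?_
    have hpow : p ^ (m - k) = p ^ (m - (k + 1)) * p := by
      rw [← pow_succ]
      congr 1
      omega
    rw [residuePart_residuePart hr, ← hpow]
    refine ih (by omega) ?_
    rw [hpow]
    calc r + p ^ (m - (k + 1)) * j < p ^ (m - (k + 1)) * (j + 1) := by
          rw [mul_add, mul_one]; omega
      _ ≤ _ := Nat.mul_le_mul_left _ hj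

/-- The fraction representing `invCapacity p m l`. -/
def invCapacityFrac (x : ℕ × ℕ × List ℤ) : ℕ × ℕ :=
  (levelTable x x.2.1).getD 0 (0, 1)

theorem primrec_invCapacityFrac : Primrec invCapacityFrac :=
  (Primrec.list_getD _).comp
    (primrec₂_levelTable.comp Primrec.id (Primrec.fst.comp Primrec.snd)) (Primrec.const 0)

theorem represents_invCapacityFrac {p : ℕ} (hp : 0 < p) (m : ℕ) (l : List ℤ) :
    Represents (invCapacityFrac (p, m, l)) (invCapacity p m l) := by
  -- At level k = m the modulus is p ^ 0 = 1, and the only entry belongs to the whole list.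
  have h := represents_levelTable hp m l le_rfl (r := 0) (by simp)
  have hl : residuePart (p ^ (m - m)) 0 l = l := by
    simp [residuePart]
  rwa [hl] at h

/-- The valuative capacity of `cosetUnion p m l`, as a function of `(p, m, l)`. -/
def capacityFun (x : ℕ × ℕ × List ℤ) : ℚ :=
  -- A zero numerator, as for the empty list with p prime, gives the value 0, in agreement with 0⁻¹
  -- = 0.
  if (invCapacityFrac x).1 = 0 then 0 else (invCapacityFrac x).2 / (invCapacityFrac x).1

theorem computableRational_capacityFun : ComputableRational capacityFun := by
  have h1 : Primrec fun x => (invCapacityFrac x).1 := Primrec.fst.comp primrec_invCapacityFrac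
  have h2 : Primrec fun x => (invCapacityFrac x).2 := Primrec.snd.comp primrec_invCapacityFrac
  have h0 : PrimrecPred fun x => (invCapacityFrac x).1 = 0 := Primrec.eq.comp h1 (Primrec.const 0)
  refine ⟨fun x => if (invCapacityFrac x).1 = 0 then 0 else Int.ofNat (invCapacityFrac x).2,
    fun x => if (invCapacityFrac x).1 = 0 then 1 else (invCapacityFrac x).1,
    (Primrec.ite h0 (Primrec.const 0) (primrec_int_ofNat.comp h2)).to_comp,
    (Primrec.ite h0 (Primrec.const 1) h1).to_comp, fun x => ?_⟩
  by_cases h : (invCapacityFrac x).1 = 0 <;> simp [capacityFun, h]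

theorem capacityFun_eq {p : ℕ} (hp : 0 < p) (m : ℕ) (l : List ℤ) :
    capacityFun (p, m, l) = (invCapacity p m l)⁻¹ := by
  rw [capacityFun, ← (represents_invCapacityFrac hp m l).2, inv_div]
  split_ifs with h <;> simp [h]

theorem mainTheorem3 :
    (∀ (p m : ℕ) (E : Set ℤ), p.Prime → E.Nonempty → IsUnionOfCosets p m E →
      ∃ q : ℚ, HasValuativeCapacity p E (q : ℝ)) ∧
    (∃ F : ℕ × ℕ × List ℤ → ℚ, ComputableRational F ∧
      (∀ (p m : ℕ) (l : List ℤ), p.Prime → l ≠ [] →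
        HasValuativeCapacity p (cosetUnion p m l) (F (p, m, l) : ℝ)) ∧
      (∀ (p : ℕ) (l : List ℤ), p.Prime → l ≠ [] →
        F (p, 0, l) = 1 / ((p : ℚ) - 1)) ∧
      (∀ (p m : ℕ) (l : List ℤ), p.Prime → l ≠ [] →
        F (p, m + 1, l) =
          (∑ j ∈ (Finset.range p).filter (fun j => residuePart p j l ≠ []),
            (1 + F (p, m, residuePart p j l))⁻¹)⁻¹)) := by
  refine ⟨fun p m E hp hE hU => ?_, capacityFun, computableRational_capacityFun,
    fun p m l hp hl => ?_, fun p l hp hl => ?_, fun p m l hp hl => ?_⟩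
  · obtain ⟨l, rfl⟩ := hU.exists_eq_cosetUnion hp.pos
    refine ⟨_, hasValuativeCapacity_cosetUnion hp m ?_⟩
    rintro rfl
    simp [cosetUnion] at hE
  · rw [capacityFun_eq hp.pos]
    exact hasValuativeCapacity_cosetUnion hp m hl
  · rw [capacityFun_eq hp.pos, invCapacity, if_neg hl, one_div]
  · simp only [capacityFun_eq hp.pos]
    exact inv_invCapacity_succ hp m l
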